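/- For positive integers $n$ and $K\le P$, the random key graph $\mathbb{K}(n;(K,P))$ is the random graph on the vertex set $\{1,\ldots,n\}$ obtained as follows: the key rings $K_1,\ldots,K_n$ are independent random sets, each uniformly distributed over the $K$-element subsets of $\{1,\ldots,P\}$, and two distinct vertices $i,j$ are adjacent if and only if $K_i\cap K_j\neq\emptyset$. Let $P(n;(K,P))$ denote the probability that $\mathbb{K}(n;(K,P))$ is connected. **Theorem.** Let $(K_n)$ and $(P_n)$ be sequences of positive integers with $K_n\le P_n$ for all $n=1,2,\ldots$ and with $K_n\ge 2$ for all $n$ sufficiently large. Let the sequence of real numbers $(\alpha_n)$ be determined by $$\frac{K_n^2}{P_n}=\frac{\log n+\alpha_n}{n},\qquad n=1,2,\ldots$$ Then $$\lim_{n\to\infty}P(n;(K_n,P_n))=0\quad\text{if}\quad\lim_{n\to\infty}\alpha_n=-\infty .$$ If, on the other hand, there exists some $\sigma>0$ such that $\sigma n\le P_n$ for all $n$ sufficiently large, then $$\lim_{n\to\infty}P(n;(K_n,P_n))=1\quad\text{if}\quad\lim_{n\to\infty}\alpha_n=+\infty .$$ -/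

import Mathlib

open MeasureTheory ProbabilityTheory Filter Topology

noncomputable section

namespace RandomKey

/-- The collection of all subsets of a pool of `P` keys which contain exactly `K` keys. -/
def KeyRing (K P : ℕ) : Type := {S : Finset (Fin P) // S.card = K}

instance (K P : ℕ) : Fintype (KeyRing K P) :=
  inferInstanceAs (Fintype {S : Finset (Fin P) // S.card = K})

instance (K P : ℕ) : MeasurableSpace (KeyRing K P) := ⊤

instance (K P : ℕ) : DiscreteMeasurableSpace (KeyRing K P) := ⟨fun _ => trivial⟩

/-- The uniform distribution on the key rings of size `K` from a pool of `P` keys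
(a probability measure whenever `K ≤ P`). -/
def keyRingLaw (K P : ℕ) : Measure (KeyRing K P) := uniformOn Set.univ

/-- The joint law of `n` independent key rings, each uniformly distributed. -/
def keyRingsLaw (n K P : ℕ) : Measure (Fin n → KeyRing K P) :=
  Measure.pi fun _ => keyRingLaw K P

/-- The graph determined by an assignment of key rings to `n` nodes: two distinct nodes are
adjacent if and only if their key rings have at least one key in common. -/
def keyGraph {n K P : ℕ} (R : Fin n → KeyRing K P) : SimpleGraph (Fin n) where
  Adj i j := i ≠ j ∧ ((R i).1 ∩ (R j).1).Nonempty
  symm := ⟨fun _ _ h => ⟨h.1.symm, by rw [Finset.inter_comm]; exact h.2⟩⟩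
  loopless := ⟨fun _ h => h.1 rfl⟩

/-- The probability that the random key graph on `n` nodes, with key rings of size `K` drawn
from a pool of `P` keys, is connected. -/
def probConnected (n K P : ℕ) : ℝ :=
  (keyRingsLaw n K P).real {R | (keyGraph R).Connected}

/-- A pair `K, P` of integer sequences is a scaling if `K n ≤ P n` for `n = 1, 2, …`. -/
def IsScaling (K P : ℕ → ℕ) : Prop := ∀ n, 1 ≤ n → K n ≤ P n

/-- A scaling is admissible if `2 ≤ K n` for all `n` sufficiently large. -/
def IsAdmissible (K P : ℕ → ℕ) : Prop := IsScaling K P ∧ ∀ᶠ n in atTop, 2 ≤ K n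

/-- `α` is the deviation function of the scaling `K, P`. -/
def IsDeviation (K P : ℕ → ℕ) (α : ℕ → ℝ) : Prop :=
  ∀ n : ℕ, 1 ≤ n → (K n : ℝ) ^ 2 / (P n : ℝ) = (Real.log n + α n) / n

end RandomKey

end

/-!
Write `N = P.choose K` and `y = n K² / P = log n + α`. Every probability is a proportion of the
`N ^ n` assignments of key rings (`keyRingsLaw_real`), so the proof is a matter of counting.

**Zero law.** An isolated node disconnects the graph, and the second moment method applies to the
number of isolated nodes. If `q` is the probability that two key rings are disjoint, a node is
isolated with probability `q ^ (n - 1)`; two nodes are both isolated with probability at most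
`q ^ (2 n - 3)`, because `choose (P - 2K) K * choose P K ≤ choose (P - K) K ^ 2`. Hence the
probability of having no isolated node is at most `1 / (n q ^ (n - 1)) + 1 / q - 1`
(`probConnected_le`), which tends to zero since `1 - K² / P ≤ q`.

**One law.** A disconnected graph has a cut: a set `S` of `r ≤ n / 2` nodes without edges to the
outside. Given the set of `U` keys held by `S`, this has probability at most `exp (-a U)` with
`a = (n - r) K / P`. If `U` were always equal to its largest value `r K`, the expected number of
cuts would be about `∑ (n e^{-y}) ^ r / r!`, which is small as `n e^{-y} = e^{-α}`. The point is to
control the event that `U` is smaller. The condition `σ n ≤ P` enters by making `K² ≥ σ y` large,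
and it is used in two ways.

* For `r ≤ n ^ (7 / 8)` and `y ≤ 8 log n`, the Laplace transform of `U` is estimated by adding the
  key rings of `S` one at a time and comparing the hypergeometric law of each overlap with a
  binomial law (`sum_pow_card_sdiff_le`, `sum_pow_card_keyUnion_le`). The overlaps change the
  exponent by `o(1)` per node, because `e^a ≤ exp √(y / σ)` is smaller than any positive power of `n`
  (`overlap_exponent_le`).
* For other `r` a cruder estimate suffices: a union bound over the sets of `t P` keys, with
  `t = min (r K / (2 P)) (1 / 4)`, shows that `U ≤ t P` has probability at most `(e t) ^ (K r / 2)`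
  (`card_filter_card_keyUnion_le_rpow`), which beats the number of choices of `S` as `K → ∞`,
  while `exp (-a t P)` is at most `exp (-r y / 4) + exp (-n K / 8)`.

Altogether the expected number of cuts is at most a geometric series whose ratio `cutRatio` tends
to zero, plus `2 ^ n exp (-n K / 8)` (`choose_mul_card_filter_isCut_le`). The connectedness of the
graph induced on `S` plays no role.
-/

namespace RandomKey

open Finset

/-! ### Counting key rings -/

theorem sum_keyRing {M : Type*} [AddCommMonoid M] (K P : ℕ) (f : Finset (Fin P) → M) :
    ∑ A : KeyRing K P, f A.1 = ∑ A ∈ powersetCard K univ, f A :=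
  (Finset.sum_subtype (p := fun A : Finset (Fin P) => A.card = K) (powersetCard K univ)
    (fun A => by simp [mem_powersetCard]) f).symm

theorem card_filter_keyRing (K P : ℕ) (p : Finset (Fin P) → Prop) [DecidablePred p] :
    #{A : KeyRing K P | p A.1} = #{A ∈ powersetCard K (univ : Finset (Fin P)) | p A} := by
  rw [card_filter, card_filter, sum_keyRing K P fun A => if p A then 1 else 0]

theorem card_keyRing (K P : ℕ) : Fintype.card (KeyRing K P) = P.choose K := by
  have := sum_keyRing K P fun _ => 1
  simpa using this

theorem card_filter_subset {P : ℕ} (K : ℕ) (V : Finset (Fin P)) :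
    #{A : KeyRing K P | A.1 ⊆ V} = V.card.choose K := by
  rw [card_filter_keyRing K P fun A => A ⊆ V, ← card_powersetCard]
  congr 1
  ext A
  simp [mem_powersetCard, and_comm]

theorem card_filter_disjoint {P : ℕ} (K : ℕ) (V : Finset (Fin P)) :
    #{A : KeyRing K P | Disjoint A.1 V} = (P - V.card).choose K := by
  have h := card_filter_subset K Vᶜ
  rw [card_compl, Fintype.card_fin] at h
  simpa only [subset_compl_iff_disjoint_right] using h

theorem card_filter_superset {P : ℕ} (K : ℕ) (B : Finset (Fin P)) (hB : B.card ≤ K) :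
    #{A : KeyRing K P | B ⊆ A.1} = (P - B.card).choose (K - B.card) := by
  rw [card_filter_keyRing K P fun A => B ⊆ A]
  have : (powersetCard (K - B.card) Bᶜ).card = (P - B.card).choose (K - B.card) := by
    rw [card_powersetCard, card_compl, Fintype.card_fin]
  rw [← this]
  refine card_bij' (fun A _ => A \ B) (fun C _ => C ∪ B) ?_ ?_ ?_ ?_
  · intro A hA
    simp only [mem_filter, mem_powersetCard] at hA ⊢
    exact ⟨fun x hx => by simp at hx ⊢; exact hx.2, by rw [card_sdiff_of_subset hA.2, hA.1.2]⟩
  · intro C hC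
    simp only [mem_filter, mem_powersetCard] at hC ⊢
    have hd : Disjoint C B := subset_compl_iff_disjoint_right.1 hC.1
    exact ⟨⟨subset_univ _, by rw [card_union_of_disjoint hd, hC.2]; omega⟩, subset_union_right⟩
  · intro A hA
    simp only [mem_filter] at hA
    exact sdiff_union_of_subset hA.2
  · intro C hC
    simp only [mem_powersetCard] at hC
    have hd : Disjoint C B := subset_compl_iff_disjoint_right.1 hC.1
    exact union_sdiff_cancel_right hd

theorem descFactorial_mul_pow_le {v P : ℕ} (h : v ≤ P) (b : ℕ) :
    v.descFactorial b * P ^ b ≤ P.descFactorial b * v ^ b := by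
  induction b with
  | zero => simp
  | succ b ih =>
    have h1 : (v - b) * P ≤ (P - b) * v := by
      rw [Nat.sub_mul, Nat.sub_mul, Nat.mul_comm P v]
      exact Nat.sub_le_sub_left (Nat.mul_le_mul_left b h) _
    calc v.descFactorial (b + 1) * P ^ (b + 1)
        = (v - b) * P * (v.descFactorial b * P ^ b) := by
          rw [Nat.descFactorial_succ, pow_succ]; ring
      _ ≤ (P - b) * v * (P.descFactorial b * v ^ b) := Nat.mul_le_mul h1 ih
      _ = _ := by rw [Nat.descFactorial_succ, pow_succ]; ring

/-- Sampling without replacement hits a set less often than sampling with replacement: the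
probability that `b` distinct keys all lie in a set of size `v` is at most `(v / P) ^ b`. -/
theorem choose_le_choose_mul_div_pow {v P : ℕ} (h : v ≤ P) (hP : 0 < P) (b : ℕ) :
    (v.choose b : ℝ) ≤ P.choose b * ((v : ℝ) / P) ^ b := by
  have h1 := descFactorial_mul_pow_le h b
  rw [Nat.descFactorial_eq_factorial_mul_choose, Nat.descFactorial_eq_factorial_mul_choose,
    mul_assoc, mul_assoc] at h1
  have h2 := Nat.le_of_mul_le_mul_left h1 b.factorial_pos
  have hP' : (0 : ℝ) < (P : ℝ) ^ b := by positivity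
  rw [div_pow, ← mul_div_assoc, le_div_iff₀ hP']
  exact_mod_cast h2

/-- The number of keys of a uniform `K`-subset outside a fixed set `V` has a generating function
dominated by that of sampling with replacement: this is the comparison of the hypergeometric
with the binomial law, coefficient by coefficient in powers of `1 - z`. -/
theorem sum_pow_card_sdiff_le {K P : ℕ} (hP : 0 < P) (V : Finset (Fin P))
    {z : ℝ} (hz0 : 0 ≤ z) (hz1 : z ≤ 1) :
    ∑ A : KeyRing K P, z ^ (A.1 \ V).card ≤
      P.choose K * (z + (V.card : ℝ) / P * (1 - z)) ^ K := by
  have expand : ∀ A : KeyRing K P, z ^ (A.1 \ V).card =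
      ∑ B ∈ V.powerset, if B ⊆ A.1 then (1 - z) ^ B.card * z ^ (K - B.card) else 0 := by
    intro A
    rw [← sum_filter]
    have h1 : V.powerset.filter (· ⊆ A.1) = (A.1 ∩ V).powerset := by
      ext B; simp only [mem_filter, mem_powerset, subset_inter_iff, and_comm]
    have h2 : (A.1 \ V).card + (A.1 ∩ V).card = K := by
      rw [card_sdiff_add_card_inter, A.2]
    rw [h1]
    have h3 := Finset.sum_pow_mul_eq_add_pow (1 - z) z (A.1 ∩ V)
    rw [sub_add_cancel, one_pow] at h3
    refine (mul_one _).symm.trans ((congrArg _ h3.symm).trans ?_)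
    rw [mul_sum]
    refine sum_congr rfl fun B hB => ?_
    have h4 := card_le_card (mem_powerset.1 hB)
    have h5 : K - B.card = (A.1 \ V).card + ((A.1 ∩ V).card - B.card) := by omega
    rw [h5, pow_add]; ring
  have hvP : V.card ≤ P := by simpa using card_le_univ V
  calc ∑ A : KeyRing K P, z ^ (A.1 \ V).card
      = ∑ B ∈ V.powerset, (#{A : KeyRing K P | B ⊆ A.1} : ℝ) *
          ((1 - z) ^ B.card * z ^ (K - B.card)) := by
        simp_rw [expand]
        rw [sum_comm]
        refine sum_congr rfl fun B _ => ?_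
        rw [← sum_filter, sum_const, nsmul_eq_mul]
    _ ≤ ∑ B ∈ V.powerset, if B.card ≤ K then
          ((P - B.card).choose (K - B.card) : ℝ) * ((1 - z) ^ B.card * z ^ (K - B.card)) else 0 := by
        refine sum_le_sum fun B _ => ?_
        split_ifs with hB
        · rw [card_filter_superset K B hB]
        · have : #{A : KeyRing K P | B ⊆ A.1} = 0 := by
            rw [card_eq_zero, filter_eq_empty_iff]
            intro A _ hA
            exact hB ((card_le_card hA).trans_eq A.2)
          rw [this]; simp
    _ = ∑ b ∈ range (V.card + 1), (V.card.choose b : ℝ) * (if b ≤ K then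
          ((P - b).choose (K - b) : ℝ) * ((1 - z) ^ b * z ^ (K - b)) else 0) := by
        rw [sum_powerset_apply_card (fun b => if b ≤ K then
          ((P - b).choose (K - b) : ℝ) * ((1 - z) ^ b * z ^ (K - b)) else 0)]
        simp [nsmul_eq_mul]
    _ ≤ ∑ b ∈ range (V.card + 1), (if b ≤ K then (P.choose K : ℝ) * (K.choose b *
          (((V.card : ℝ) / P * (1 - z)) ^ b * z ^ (K - b))) else 0) := by
        refine sum_le_sum fun b _ => ?_
        split_ifs with hb
        · have h1 := choose_le_choose_mul_div_pow hvP hP b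
          have hw : 0 ≤ (1 - z) ^ b * z ^ (K - b) :=
            mul_nonneg (pow_nonneg (by linarith) _) (pow_nonneg hz0 _)
          have h2 : (P.choose K : ℝ) * K.choose b = P.choose b * (P - b).choose (K - b) := by
            exact_mod_cast Nat.choose_mul hb
          calc (V.card.choose b : ℝ) * (((P - b).choose (K - b) : ℝ) *
                ((1 - z) ^ b * z ^ (K - b)))
              ≤ (P.choose b * ((V.card : ℝ) / P) ^ b) * (((P - b).choose (K - b) : ℝ) *
                ((1 - z) ^ b * z ^ (K - b))) := by gcongr
            _ = (P.choose b * (P - b).choose (K - b)) * (((V.card : ℝ) / P) ^ b *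
                ((1 - z) ^ b * z ^ (K - b))) := by ring
            _ = _ := by rw [← h2, mul_pow]; ring
        · simp
    _ ≤ ∑ b ∈ range (K + 1), (P.choose K : ℝ) * (K.choose b *
          (((V.card : ℝ) / P * (1 - z)) ^ b * z ^ (K - b))) := by
        rw [← sum_filter]
        refine sum_le_sum_of_subset_of_nonneg ?_ fun b _ _ => ?_
        · intro b hb; simp at hb ⊢; omega
        · have : 0 ≤ 1 - z := by linarith
          positivity
    _ = _ := by
        rw [add_comm z, add_pow, mul_sum]
        refine sum_congr rfl fun b _ => by ring

/-- The probability that a key ring misses `v` given keys is at most `exp (-K v / P)`. -/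
theorem choose_sub_le_exp {K P v : ℕ} (hP : 0 < P) (hv : v ≤ P) :
    ((P - v).choose K : ℝ) ≤ P.choose K * Real.exp (-(K * v / P : ℝ)) := by
  have hP' : (0 : ℝ) < P := by exact_mod_cast hP
  have h1 := choose_le_choose_mul_div_pow (Nat.sub_le P v) hP K
  have h2 : ((P - v : ℕ) : ℝ) / P ≤ Real.exp (-(v / P : ℝ)) := by
    rw [Nat.cast_sub hv, sub_div, div_self hP'.ne']
    exact Real.one_sub_le_exp_neg _
  calc ((P - v).choose K : ℝ) ≤ P.choose K * (((P - v : ℕ) : ℝ) / P) ^ K := h1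
    _ ≤ P.choose K * (Real.exp (-(v / P : ℝ))) ^ K := by gcongr
    _ = _ := by rw [← Real.exp_nat_mul]; congr 2; ring

/-! ### Probabilities as proportions -/

open Classical in
theorem keyRingsLaw_real {n K P : ℕ} (hKP : K ≤ P) (E : Set (Fin n → KeyRing K P)) :
    (keyRingsLaw n K P).real E = (#{R | R ∈ E} : ℝ) / (P.choose K : ℝ) ^ n := by
  have hN : 0 < Fintype.card (KeyRing K P) := by rw [card_keyRing]; exact Nat.choose_pos hKP
  have : Nonempty (KeyRing K P) := Fintype.card_pos_iff.1 hN
  have hlaw : keyRingsLaw n K P = uniformOn Set.univ := by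
    unfold keyRingsLaw keyRingLaw
    rw [← Set.pi_univ (Set.univ : Set (Fin n)), uniformOn_pi]
  rw [hlaw, Measure.real, uniformOn_univ, ENNReal.toReal_div]
  congr 1
  · rw [← Set.coe_toFinset E, Measure.count_apply_finset]
    simp [Set.toFinset]
  · simp [card_keyRing]

/-! ### The number of keys held by a set of nodes -/

/-- The set of all keys occurring in a family of key rings. -/
def keyUnion {ι : Type*} [Fintype ι] {K P : ℕ} (f : ι → KeyRing K P) : Finset (Fin P) :=
  univ.biUnion fun i => (f i).1

theorem card_keyUnion_le {ι : Type*} [Fintype ι] {K P : ℕ} (f : ι → KeyRing K P) :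
    (keyUnion f).card ≤ Fintype.card ι * K :=
  card_biUnion_le_card_mul _ _ _ fun i _ => (f i).2.le

theorem card_keyUnion_le_pool {ι : Type*} [Fintype ι] {K P : ℕ} (f : ι → KeyRing K P) :
    (keyUnion f).card ≤ P := by
  simpa using card_le_univ (keyUnion f)

theorem keyUnion_subset_iff {ι : Type*} [Fintype ι] {K P : ℕ} {f : ι → KeyRing K P}
    {T : Finset (Fin P)} : keyUnion f ⊆ T ↔ ∀ i, (f i).1 ⊆ T := by
  simp [keyUnion]

theorem disjoint_keyUnion_iff {ι : Type*} [Fintype ι] {K P : ℕ} {f : ι → KeyRing K P}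
    {T : Finset (Fin P)} : Disjoint T (keyUnion f) ↔ ∀ i, Disjoint (f i).1 T := by
  simp [keyUnion, disjoint_biUnion_right, disjoint_comm]

theorem keyUnion_comp_equiv {ι κ : Type*} [Fintype ι] [Fintype κ] {K P : ℕ} (e : κ ≃ ι)
    (f : ι → KeyRing K P) : keyUnion (f ∘ e) = keyUnion f := by
  ext x
  simp only [keyUnion, mem_biUnion, mem_univ, true_and, Function.comp]
  exact ⟨fun ⟨i, h⟩ => ⟨e i, h⟩, fun ⟨i, h⟩ => ⟨e.symm i, by simpa using h⟩⟩

theorem sum_pow_card_keyUnion_fin_le {K P : ℕ} (hP : 0 < P) {z s : ℝ} (hz0 : 0 ≤ z) (hz1 : z ≤ 1) :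
    ∀ r : ℕ, (r * K : ℝ) ≤ s * P →
      ∑ f : Fin r → KeyRing K P, z ^ (keyUnion f).card ≤
        (P.choose K * (z + s * (1 - z)) ^ K) ^ r := by
  intro r
  have hP' : (0 : ℝ) < P := by exact_mod_cast hP
  induction r with
  | zero => intro _; simp [keyUnion]
  | succ r ih =>
    intro hr
    have hr' : (r * K : ℝ) ≤ s * P := by
      refine le_trans ?_ hr
      gcongr
      exact_mod_cast r.le_succ
    have hs : 0 ≤ s := by
      by_contra h
      have : (0 : ℝ) ≤ r * K := by positivity
      nlinarith
    have hU : ∀ (A : KeyRing K P) (f : Fin r → KeyRing K P),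
        (keyUnion (Fin.cons A f : Fin (r + 1) → KeyRing K P)).card =
          (A.1 \ keyUnion f).card + (keyUnion f).card := by
      intro A f
      have : keyUnion (Fin.cons A f : Fin (r + 1) → KeyRing K P) = A.1 \ keyUnion f ∪ keyUnion f := by
        ext x
        simp [keyUnion, Fin.exists_fin_succ]
      rw [this, card_union_of_disjoint sdiff_disjoint]
    have h1z : 0 ≤ 1 - z := by linarith
    calc ∑ f : Fin (r + 1) → KeyRing K P, z ^ (keyUnion f).card
        = ∑ f : Fin r → KeyRing K P, z ^ (keyUnion f).card *
            ∑ A : KeyRing K P, z ^ (A.1 \ keyUnion f).card := by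
          rw [← (Fin.consEquiv fun _ => KeyRing K P).sum_comp, Fintype.sum_prod_type_right]
          refine sum_congr rfl fun f _ => ?_
          rw [mul_sum]
          refine sum_congr rfl fun A _ => ?_
          change z ^ (keyUnion (Fin.cons A f : Fin (r + 1) → KeyRing K P)).card = _
          rw [hU, pow_add, mul_comm]
      _ ≤ ∑ f : Fin r → KeyRing K P, z ^ (keyUnion f).card *
            (P.choose K * (z + s * (1 - z)) ^ K) := by
          refine sum_le_sum fun f _ => ?_
          refine mul_le_mul_of_nonneg_left ?_ (pow_nonneg hz0 _)
          refine (sum_pow_card_sdiff_le hP _ hz0 hz1).trans ?_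
          have h1 : ((keyUnion f).card : ℝ) / P ≤ s := by
            rw [div_le_iff₀ hP']
            refine le_trans ?_ hr'
            have := card_keyUnion_le f
            rw [Fintype.card_fin] at this
            exact_mod_cast this
          gcongr
      _ ≤ _ := by
          rw [← sum_mul, pow_succ]
          exact mul_le_mul_of_nonneg_right (ih hr') (by positivity)

/-- The union of `r` random key rings of size `K` is stochastically as large, in the sense of
Laplace transforms, as `r * K` independent trials each of which fails with probability `s`, an
upper bound for the proportion of the pool that the other rings can occupy. -/
theorem sum_pow_card_keyUnion_le {ι : Type*} [Fintype ι] [DecidableEq ι] {K P : ℕ} (hP : 0 < P)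
    {z s : ℝ} (hz0 : 0 ≤ z) (hz1 : z ≤ 1) (hs : (Fintype.card ι * K : ℝ) ≤ s * P) :
    ∑ f : ι → KeyRing K P, z ^ (keyUnion f).card ≤
      (P.choose K * (z + s * (1 - z)) ^ K) ^ Fintype.card ι := by
  refine le_of_eq_of_le ?_ (sum_pow_card_keyUnion_fin_le hP hz0 hz1 _ hs)
  let e := Fintype.equivFin ι
  refine Fintype.sum_equiv (e.arrowCongr (Equiv.refl _)) _ _ fun f => ?_
  have := keyUnion_comp_equiv e.symm f
  change _ = z ^ (keyUnion (f ∘ e.symm)).card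
  rw [this]

theorem card_filter_card_keyUnion_le {ι : Type*} [Fintype ι] [DecidableEq ι] {K P : ℕ} {m : ℕ}
    (hm : m ≤ P) :
    #{f : ι → KeyRing K P | (keyUnion f).card ≤ m} ≤
      P.choose m * (m.choose K) ^ Fintype.card ι := by
  classical
  have hsub : ({f : ι → KeyRing K P | (keyUnion f).card ≤ m} : Finset _) ⊆
      (powersetCard m (univ : Finset (Fin P))).biUnion fun T =>
        Fintype.piFinset fun _ : ι => ({A : KeyRing K P | A.1 ⊆ T} : Finset _) := by
    intro f hf
    simp only [mem_filter, mem_univ, true_and] at hf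
    obtain ⟨T, hT1, -, hT2⟩ := exists_subsuperset_card_eq (subset_univ (keyUnion f)) hf (by simpa)
    simp only [mem_biUnion, mem_powersetCard, Fintype.mem_piFinset, mem_filter, mem_univ, true_and]
    exact ⟨T, ⟨subset_univ _, hT2⟩, keyUnion_subset_iff.1 hT1⟩
  refine (card_le_card hsub).trans ?_
  refine (card_biUnion_le_card_mul _ _ ((m.choose K) ^ Fintype.card ι) fun T hT => ?_).trans_eq ?_
  · rw [Fintype.card_piFinset, prod_const, card_filter_subset, (mem_powersetCard.1 hT).2, card_univ]
  · rw [card_powersetCard, card_univ, Fintype.card_fin]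

theorem choose_mul_pow_le_exp {P m : ℕ} (hm : m ≤ P) {t : ℝ} (ht : 0 ≤ t) :
    (P.choose m : ℝ) * t ^ m ≤ Real.exp (t * P) := by
  calc (P.choose m : ℝ) * t ^ m ≤ ∑ k ∈ range (P + 1), t ^ k * 1 ^ (P - k) * P.choose k := by
        refine le_of_eq_of_le ?_ (single_le_sum (f := fun k => t ^ k * 1 ^ (P - k) * P.choose k)
          (fun k _ => by positivity) (mem_range.2 (Nat.lt_succ_of_le hm)))
        simp [mul_comm]
    _ = (t + 1) ^ P := (add_pow t 1 P).symm
    _ ≤ (Real.exp t) ^ P := by gcongr; exact Real.add_one_le_exp t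
    _ = _ := by rw [← Real.exp_nat_mul, mul_comm]

/-- The union bound over the sets of `t * P` keys that could contain all the key rings. -/
theorem card_filter_card_keyUnion_le_rpow {ι : Type*} [Fintype ι] [DecidableEq ι] {K P : ℕ}
    (hP : 0 < P) {t : ℝ} (ht0 : 0 < t) (ht1 : t ≤ 1)
    (ht : t * P ≤ (K * Fintype.card ι : ℝ) / 2) :
    (#{f : ι → KeyRing K P | ((keyUnion f).card : ℝ) ≤ t * P} : ℝ) ≤
      (P.choose K : ℝ) ^ Fintype.card ι * (Real.exp 1 * t) ^ ((K * Fintype.card ι : ℝ) / 2) := by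
  set r := Fintype.card ι
  have hP' : (0 : ℝ) < P := by exact_mod_cast hP
  set m := ⌊t * P⌋₊ with hm
  have hmt : (m : ℝ) ≤ t * P := Nat.floor_le (by positivity)
  have hmP : m ≤ P := by
    have : (m : ℝ) ≤ P := hmt.trans (by nlinarith)
    exact_mod_cast this
  have hmKr : m ≤ K * r := by
    have : (m : ℝ) ≤ K * r := by
      have : (0 : ℝ) ≤ K * r := by positivity
      linarith
    exact_mod_cast this
  have h1 : (#{f : ι → KeyRing K P | ((keyUnion f).card : ℝ) ≤ t * P} : ℝ) ≤
      P.choose m * ((m.choose K : ℕ) : ℝ) ^ r := by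
    have h2 := card_filter_card_keyUnion_le (ι := ι) (K := K) hmP
    have h3 : ∀ f : ι → KeyRing K P, ((keyUnion f).card : ℝ) ≤ t * P ↔ (keyUnion f).card ≤ m :=
      fun f => (Nat.le_floor_iff (by positivity)).symm
    simp_rw [h3]
    exact_mod_cast h2
  have h2 : (m.choose K : ℝ) ≤ P.choose K * t ^ K := by
    refine (choose_le_choose_mul_div_pow hmP hP K).trans ?_
    have : (m : ℝ) / P ≤ t := by rwa [div_le_iff₀ hP']
    gcongr
  have h3 : (P.choose m : ℝ) * t ^ (K * r) ≤ (Real.exp 1 * t) ^ ((K * r : ℝ) / 2) := by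
    -- `choose P m ≤ exp (t * P) / t ^ m`, and half of the factors of `t ^ (K * r)` pay for `t ^ m`.
    have hsplit : t ^ (K * r) = t ^ m * t ^ (K * r - m) := by
      rw [← pow_add]; congr 1; omega
    have h4 : t ^ (K * r - m) ≤ t ^ ((K * r : ℝ) / 2) := by
      rw [← Real.rpow_natCast]
      refine Real.rpow_le_rpow_of_exponent_ge ht0 ht1 ?_
      rw [Nat.cast_sub hmKr]; push_cast; linarith
    rw [hsplit, ← mul_assoc, Real.mul_rpow (Real.exp_pos _).le ht0.le, Real.exp_one_rpow]
    refine mul_le_mul ((choose_mul_pow_le_exp hmP ht0.le).trans ?_) h4 (by positivity)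
      (Real.exp_pos _).le
    exact Real.exp_le_exp.2 ht
  calc _ ≤ P.choose m * ((m.choose K : ℕ) : ℝ) ^ r := h1
    _ ≤ P.choose m * (P.choose K * t ^ K) ^ r := by gcongr
    _ = (P.choose K : ℝ) ^ r * (P.choose m * t ^ (K * r)) := by rw [mul_pow, ← pow_mul]; ring
    _ ≤ _ := by gcongr

/-! ### Sets of nodes without edges to their complement -/

/-- No node of `S` shares a key with a node outside `S`. -/
def IsCut {n K P : ℕ} (R : Fin n → KeyRing K P) (S : Finset (Fin n)) : Prop :=
  ∀ i ∈ S, ∀ j ∉ S, Disjoint (R j).1 (R i).1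

theorem IsCut.compl {n K P : ℕ} {R : Fin n → KeyRing K P} {S : Finset (Fin n)}
    (h : IsCut R S) : IsCut R Sᶜ := by
  intro i hi j hj
  rw [mem_compl] at hi
  rw [mem_compl, not_not] at hj
  exact (h j hj i hi).symm

/-- The small side of the cut is the component of a node or the complement of that component. -/
theorem exists_isCut_of_not_connected {n K P : ℕ} (hn : 0 < n) {R : Fin n → KeyRing K P}
    (h : ¬ (keyGraph R).Connected) : ∃ S, 1 ≤ S.card ∧ 2 * S.card ≤ n ∧ IsCut R S := by
  classical
  rw [SimpleGraph.connected_iff_exists_forall_reachable] at h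
  push Not at h
  let v : Fin n := ⟨0, hn⟩
  obtain ⟨w, hw⟩ := h v
  let S : Finset (Fin n) := {u | (keyGraph R).Reachable v u}
  have hcut : IsCut R S := by
    intro i hi j hj
    simp only [S, mem_filter, mem_univ, true_and] at hi hj
    by_contra hd
    apply hj
    refine hi.trans (SimpleGraph.Adj.reachable ⟨?_, ?_⟩)
    · rintro rfl; exact hj hi
    · rw [disjoint_comm, disjoint_iff_inter_eq_empty] at hd
      exact nonempty_iff_ne_empty.2 hd
  have hS1 : 1 ≤ S.card := card_pos.2 ⟨v, by simp [S]⟩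
  have hS2 : 1 ≤ Sᶜ.card := card_pos.2 ⟨w, by simpa [S] using hw⟩
  have hsum : S.card + Sᶜ.card = n := by rw [card_add_card_compl, Fintype.card_fin]
  by_cases hc : 2 * S.card ≤ n
  · exact ⟨S, hS1, hc, hcut⟩
  · exact ⟨Sᶜ, hS2, by omega, hcut.compl⟩

open Classical in
/-- Once the key rings of `S` are fixed, the other nodes draw theirs independently from the
remaining pool. -/
theorem card_filter_isCut {n K P : ℕ} (S : Finset (Fin n)) :
    #{R : Fin n → KeyRing K P | IsCut R S} =
      ∑ f : {i // i ∈ S} → KeyRing K P, ((P - (keyUnion f).card).choose K) ^ (n - S.card) := by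
  rw [card_filter, ← (Equiv.piEquivPiSubtypeProd (· ∈ S) fun _ => KeyRing K P).symm.sum_comp,
    Fintype.sum_prod_type]
  refine sum_congr rfl fun f _ => ?_
  rw [← card_filter]
  have hcut : ∀ g : {i // i ∉ S} → KeyRing K P,
      IsCut ((Equiv.piEquivPiSubtypeProd (· ∈ S) fun _ => KeyRing K P).symm (f, g)) S ↔
        g ∈ Fintype.piFinset fun _ : {i // i ∉ S} =>
          ({A : KeyRing K P | Disjoint A.1 (keyUnion f)} : Finset _) := by
    intro g
    simp only [IsCut, Fintype.mem_piFinset, mem_filter, mem_univ, true_and, disjoint_keyUnion_iff,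
      Equiv.piEquivPiSubtypeProd_symm_apply]
    constructor
    · intro h j i
      have := h i i.2 j j.2
      rw [dif_pos i.2, dif_neg j.2] at this
      exact this.symm
    · intro h i hi j hj
      rw [dif_pos hi, dif_neg hj]
      exact (h ⟨j, hj⟩ ⟨i, hi⟩).symm
  simp_rw [hcut]
  rw [filter_univ_mem, Fintype.card_piFinset, prod_const, card_filter_disjoint, card_univ,
    Fintype.card_subtype_compl, Fintype.card_fin, Fintype.card_coe]

open Classical in
theorem card_filter_isCut_le {n K P : ℕ} (hP : 0 < P) (S : Finset (Fin n)) :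
    (#{R : Fin n → KeyRing K P | IsCut R S} : ℝ) ≤ (P.choose K : ℝ) ^ (n - S.card) *
      ∑ f : {i // i ∈ S} → KeyRing K P,
        Real.exp (-((n - S.card : ℕ) * K / P : ℝ)) ^ (keyUnion f).card := by
  rw [card_filter_isCut, Nat.cast_sum, mul_sum]
  refine sum_le_sum fun f _ => ?_
  rw [Nat.cast_pow]
  refine (pow_le_pow_left₀ (by positivity)
    (choose_sub_le_exp hP (card_keyUnion_le_pool f)) _).trans_eq ?_
  rw [mul_pow, ← Real.exp_nat_mul, ← Real.exp_nat_mul]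
  congr 2
  ring

open Classical in
/-- The probability that `S` is cut off, with an explicit correction `s * (exp a - 1)` for the
overlaps among the key rings of `S`; without overlaps the exponent would be `-r K a`. -/
theorem card_filter_isCut_le_exp {n K P : ℕ} (hP : 0 < P) (S : Finset (Fin n)) {a s : ℝ}
    (ha : a = (n - S.card : ℕ) * K / P) (hs : s = S.card * K / P) :
    (#{R : Fin n → KeyRing K P | IsCut R S} : ℝ) ≤ (P.choose K : ℝ) ^ n *
      Real.exp (S.card * (K * (s * (Real.exp a - 1) - a))) := by
  have hP' : (0 : ℝ) < P := by exact_mod_cast hP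
  have ha0 : 0 ≤ a := by rw [ha]; positivity
  have hs0 : 0 ≤ s := by rw [hs]; positivity
  have hSn : S.card ≤ n := by simpa using card_le_univ S
  have hz1 : Real.exp (-a) ≤ 1 := Real.exp_le_one_iff.2 (by linarith)
  have hbase : Real.exp (-a) + s * (1 - Real.exp (-a)) ≤ Real.exp (s * (Real.exp a - 1) - a) := by
    have h1 : Real.exp (-a) + s * (1 - Real.exp (-a)) =
        Real.exp (-a) * (s * (Real.exp a - 1) + 1) := by
      have : Real.exp (-a) * Real.exp a = 1 := by rw [← Real.exp_add]; simp
      linear_combination (-s) * this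
    rw [h1, sub_eq_neg_add (s * _) a, Real.exp_add]
    gcongr
    exact Real.add_one_le_exp _
  refine (card_filter_isCut_le hP S).trans ?_
  rw [← ha]
  have h2 := sum_pow_card_keyUnion_le (ι := {i // i ∈ S}) (K := K) hP (Real.exp_pos (-a)).le hz1
    (s := s) (by rw [hs, Fintype.card_coe]; field_simp; rfl)
  rw [Fintype.card_coe] at h2
  calc _ ≤ (P.choose K : ℝ) ^ (n - S.card) * ((P.choose K : ℝ) *
        (Real.exp (-a) + s * (1 - Real.exp (-a))) ^ K) ^ S.card := by gcongr
    _ ≤ (P.choose K : ℝ) ^ (n - S.card) * ((P.choose K : ℝ) *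
        (Real.exp (s * (Real.exp a - 1) - a)) ^ K) ^ S.card := by
      have : 0 ≤ 1 - Real.exp (-a) := by linarith
      gcongr
    _ = (P.choose K : ℝ) ^ (n - S.card + S.card) *
        ((Real.exp (s * (Real.exp a - 1) - a)) ^ K) ^ S.card := by rw [mul_pow, pow_add]; ring
    _ = _ := by
      rw [Nat.sub_add_cancel hSn, ← Real.exp_nat_mul, ← Real.exp_nat_mul]

open Classical in
/-- The probability that `S` is cut off, split according to whether the nodes of `S` hold more
than a proportion `t` of the pool. -/
theorem card_filter_isCut_le_add {n K P : ℕ} (hP : 0 < P) (S : Finset (Fin n))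
    {t : ℝ} (ht0 : 0 < t) (ht1 : t ≤ 1) (ht : t * P ≤ (K * S.card : ℝ) / 2) :
    (#{R : Fin n → KeyRing K P | IsCut R S} : ℝ) ≤ (P.choose K : ℝ) ^ n *
      ((Real.exp 1 * t) ^ ((K * S.card : ℝ) / 2) + Real.exp (-((n - S.card : ℕ) * K * t))) := by
  have hP' : (0 : ℝ) < P := by exact_mod_cast hP
  have hSn : S.card ≤ n := by simpa using card_le_univ S
  set a : ℝ := (n - S.card : ℕ) * K / P with ha
  have ha0 : 0 ≤ a := by positivity
  have hz1 : Real.exp (-a) ≤ 1 := Real.exp_le_one_iff.2 (by linarith)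
  have hN : (0 : ℝ) ≤ P.choose K := by positivity
  refine (card_filter_isCut_le hP S).trans ?_
  have hterm : ∀ f : {i // i ∈ S} → KeyRing K P, Real.exp (-a) ^ (keyUnion f).card ≤
      (if ((keyUnion f).card : ℝ) ≤ t * P then 1 else 0) +
        Real.exp (-((n - S.card : ℕ) * K * t)) := by
    intro f
    split_ifs with h
    · have := pow_le_one₀ (n := (keyUnion f).card) (Real.exp_pos (-a)).le hz1
      have := Real.exp_pos (-((n - S.card : ℕ) * K * t : ℝ))
      linarith
    · rw [zero_add, ← Real.exp_nat_mul]
      refine Real.exp_le_exp.2 ?_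
      have h1 : ((n - S.card : ℕ) * K * t : ℝ) = a * (t * P) := by rw [ha]; field_simp
      rw [h1]
      have := mul_le_mul_of_nonneg_left (not_le.1 h).le ha0
      linarith
  have hcard := card_filter_card_keyUnion_le_rpow (ι := {i // i ∈ S}) (K := K) hP ht0 ht1
    (by rwa [Fintype.card_coe])
  rw [Fintype.card_coe] at hcard
  calc _ ≤ (P.choose K : ℝ) ^ (n - S.card) * ∑ f : {i // i ∈ S} → KeyRing K P,
          ((if ((keyUnion f).card : ℝ) ≤ t * P then 1 else 0) +
        Real.exp (-((n - S.card : ℕ) * K * t))) := by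
        gcongr with f
        exact hterm f
    _ = (P.choose K : ℝ) ^ (n - S.card) *
        ((#{f : {i // i ∈ S} → KeyRing K P | ((keyUnion f).card : ℝ) ≤ t * P} : ℝ) +
          (P.choose K : ℝ) ^ S.card * Real.exp (-((n - S.card : ℕ) * K * t))) := by
        rw [sum_add_distrib, sum_const, card_univ, Fintype.card_fun, card_keyRing, Fintype.card_coe,
          sum_boole, nsmul_eq_mul]
        push_cast
        rfl
    _ ≤ (P.choose K : ℝ) ^ (n - S.card) *
        ((P.choose K : ℝ) ^ S.card * (Real.exp 1 * t) ^ ((K * S.card : ℝ) / 2) +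
          (P.choose K : ℝ) ^ S.card * Real.exp (-((n - S.card : ℕ) * K * t))) := by gcongr
    _ = (P.choose K : ℝ) ^ (n - S.card + S.card) * ((Real.exp 1 * t) ^ ((K * S.card : ℝ) / 2) +
          Real.exp (-((n - S.card : ℕ) * K * t))) := by rw [pow_add]; ring
    _ = _ := by rw [Nat.sub_add_cancel hSn]

/-- The union bound over all possible small sides of a cut. -/
theorem one_sub_probConnected_le {n K P : ℕ} (hn : 0 < n) (hKP : K ≤ P) (B : ℕ → ℝ)
    (hB : ∀ S : Finset (Fin n), 1 ≤ S.card → 2 * S.card ≤ n →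
      (open Classical in (#{R : Fin n → KeyRing K P | IsCut R S} : ℝ)) ≤
        (P.choose K : ℝ) ^ n * B S.card) :
    1 - probConnected n K P ≤ ∑ r ∈ Icc 1 (n / 2), n.choose r * B r := by
  classical
  have hN : (0 : ℝ) < (P.choose K : ℝ) ^ n := by
    have : 0 < P.choose K := Nat.choose_pos hKP
    positivity
  have htot : (#{R : Fin n → KeyRing K P | (keyGraph R).Connected} : ℝ) +
      (#{R : Fin n → KeyRing K P | ¬ (keyGraph R).Connected} : ℝ) = (P.choose K : ℝ) ^ n := by
    have h1 := card_filter_add_card_filter_not (s := (univ : Finset (Fin n → KeyRing K P)))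
      (fun R => (keyGraph R).Connected)
    rw [card_univ, Fintype.card_fun, card_keyRing, Fintype.card_fin] at h1
    exact_mod_cast h1
  have hsub : ({R : Fin n → KeyRing K P | ¬ (keyGraph R).Connected} : Finset _) ⊆
      (Icc 1 (n / 2)).biUnion fun r => (powersetCard r univ).biUnion fun S =>
        {R : Fin n → KeyRing K P | IsCut R S} := by
    intro R hR
    simp only [mem_filter, mem_univ, true_and] at hR
    obtain ⟨S, h1, h2, h3⟩ := exists_isCut_of_not_connected hn hR
    simp only [mem_biUnion, mem_Icc, mem_powersetCard, mem_filter, mem_univ, true_and]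
    exact ⟨S.card, ⟨h1, by omega⟩, S, ⟨subset_univ _, rfl⟩, h3⟩
  have hcount : (#{R : Fin n → KeyRing K P | ¬ (keyGraph R).Connected} : ℝ) ≤
      (P.choose K : ℝ) ^ n * ∑ r ∈ Icc 1 (n / 2), n.choose r * B r := by
    calc (#{R : Fin n → KeyRing K P | ¬ (keyGraph R).Connected} : ℝ)
        ≤ ∑ r ∈ Icc 1 (n / 2), ∑ S ∈ powersetCard r (univ : Finset (Fin n)),
            (#{R : Fin n → KeyRing K P | IsCut R S} : ℝ) := by
          have h1 := (card_le_card hsub).trans (card_biUnion_le.trans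
            (sum_le_sum fun r _ => card_biUnion_le))
          exact_mod_cast h1
      _ ≤ ∑ r ∈ Icc 1 (n / 2), ∑ S ∈ powersetCard r (univ : Finset (Fin n)),
            (P.choose K : ℝ) ^ n * B r := by
          refine sum_le_sum fun r hr => sum_le_sum fun S hS => ?_
          obtain ⟨-, hS⟩ := mem_powersetCard.1 hS
          rw [mem_Icc] at hr
          rw [← hS]
          exact hB S (by omega) (by omega)
      _ = _ := by
          rw [mul_sum]
          refine sum_congr rfl fun r _ => ?_
          rw [sum_const, card_powersetCard, card_univ, Fintype.card_fin, nsmul_eq_mul]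
          ring
  have hprob : probConnected n K P =
      (#{R : Fin n → KeyRing K P | (keyGraph R).Connected} : ℝ) / (P.choose K : ℝ) ^ n := by
    unfold probConnected
    rw [keyRingsLaw_real hKP]
    simp
  rw [hprob, sub_le_iff_le_add, ← sub_le_iff_le_add', le_div_iff₀ hN]
  linarith

/-! ### Estimates for the sum over cuts -/

theorem choose_le_exp_mul_div_pow {n r : ℕ} (hr : 1 ≤ r) :
    (n.choose r : ℝ) ≤ (Real.exp 1 * n / r) ^ r := by
  have hr' : (0 : ℝ) < r := by exact_mod_cast hr
  have h1 : (n.choose r : ℝ) ≤ (n : ℝ) ^ r / r.factorial := Nat.choose_le_pow_div r n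
  have h2 : (r : ℝ) ^ r / r.factorial ≤ Real.exp r := Real.pow_div_factorial_le_exp _ hr'.le r
  have h3 : Real.exp 1 ^ r = Real.exp r := by rw [← Real.exp_nat_mul, mul_one]
  refine h1.trans ?_
  rw [div_pow, mul_pow, h3, div_le_div_iff₀ (by positivity) (by positivity)]
  rw [div_le_iff₀ (by positivity)] at h2
  calc (n : ℝ) ^ r * (r : ℝ) ^ r ≤ (n : ℝ) ^ r * (Real.exp r * r.factorial) := by gcongr
    _ = _ := by ring

theorem choose_le_pow_cast (n r : ℕ) : (n.choose r : ℝ) ≤ (n : ℝ) ^ r := by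
  exact_mod_cast Nat.choose_le_pow n r

theorem pow_add_pow_le_add_pow {x y : ℝ} (hx : 0 ≤ x) (hy : 0 ≤ y) {r : ℕ} (hr : 1 ≤ r) :
    x ^ r + y ^ r ≤ (x + y) ^ r := by
  obtain ⟨k, rfl⟩ := Nat.exists_eq_add_of_le' hr
  have h1 : x ^ k ≤ (x + y) ^ k := by gcongr; linarith
  have h2 : y ^ k ≤ (x + y) ^ k := by gcongr; linarith
  calc x ^ (k + 1) + y ^ (k + 1) = x ^ k * x + y ^ k * y := by ring
    _ ≤ (x + y) ^ k * x + (x + y) ^ k * y := by gcongr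
    _ = _ := by ring

/-- The ratio of the geometric series bounding the expected number of sets of nodes that hold
few keys, when `P ≥ σ n`. -/
noncomputable def clusterRatio (σ : ℝ) (K : ℕ) : ℝ :=
  Real.exp 1 ^ 2 / (2 * σ) * K * (Real.exp 1 / 4) ^ ((K : ℝ) / 2 - 1)

/-- The error in the exponent, per node, caused by overlaps between the key rings of at most
`n ^ (7 / 8)` nodes, where `L = log n`. -/
noncomputable def overlapError (σ L : ℝ) : ℝ :=
  8 * L * Real.exp (-(L / 8) + Real.sqrt (8 * L / σ))

/-- The ratio of the geometric series bounding the expected number of cuts, where `y = n K² / P`: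
the terms account for sets holding few keys, for large approximate mean degree `y`, for sets of more than
`n ^ (7 / 8)` nodes and for the remaining sets. -/
noncomputable def cutRatio (σ : ℝ) (n K : ℕ) (y : ℝ) : ℝ :=
  clusterRatio σ K + Real.exp (-Real.log n) + Real.exp (1 - Real.log n / 8) +
    Real.exp (Real.log n - y + 2 * overlapError σ (Real.log n))

theorem clusterRatio_nonneg {σ : ℝ} (hσ : 0 < σ) (K : ℕ) : 0 ≤ clusterRatio σ K := by
  unfold clusterRatio; positivity

theorem choose_mul_rpow_le_clusterRatio_pow {n K P r : ℕ} {σ : ℝ} (hσ : 0 < σ) (hn : 0 < n)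
    (hP : σ * n ≤ P) (hK : 2 ≤ K) (hr : 1 ≤ r) {t : ℝ} (ht0 : 0 < t) (ht4 : t ≤ 1 / 4)
    (ht : t ≤ r * K / (2 * P)) :
    (n.choose r : ℝ) * (Real.exp 1 * t) ^ ((K * r : ℝ) / 2) ≤ clusterRatio σ K ^ r := by
  have hr' : (0 : ℝ) < r := by exact_mod_cast hr
  have hn' : (0 : ℝ) < n := by exact_mod_cast hn
  have hP' : (0 : ℝ) < P := (by positivity : 0 < σ * n).trans_le hP
  have hK' : (2 : ℝ) ≤ K := by exact_mod_cast hK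
  have het : 0 < Real.exp 1 * t := by positivity
  have h1 : (Real.exp 1 * t) ^ ((K * r : ℝ) / 2) = ((Real.exp 1 * t) ^ ((K : ℝ) / 2)) ^ r := by
    rw [← Real.rpow_mul_natCast het.le]; congr 1; ring
  -- One factor `e t ≤ e r K / (2 P)` is kept aside to cancel `n / r` in the binomial coefficient.
  have h2 : (Real.exp 1 * t) ^ ((K : ℝ) / 2) ≤
      Real.exp 1 * (r * K / (2 * P)) * (Real.exp 1 / 4) ^ ((K : ℝ) / 2 - 1) := by
    have : (K : ℝ) / 2 = 1 + (K / 2 - 1) := by ring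
    rw [this, Real.rpow_add het, Real.rpow_one]
    have h3 : (Real.exp 1 * t) ^ ((K : ℝ) / 2 - 1) ≤ (Real.exp 1 / 4) ^ ((K : ℝ) / 2 - 1) := by
      refine Real.rpow_le_rpow het.le ?_ (by linarith)
      have := mul_le_mul_of_nonneg_left ht4 (Real.exp_pos 1).le
      linarith
    rw [← this]
    gcongr
  rw [h1]
  calc _ ≤ (Real.exp 1 * n / r) ^ r *
        (Real.exp 1 * (r * K / (2 * P)) * (Real.exp 1 / 4) ^ ((K : ℝ) / 2 - 1)) ^ r := by
        gcongr
        exact choose_le_exp_mul_div_pow hr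
    _ = (Real.exp 1 ^ 2 / 2 * K * (n / P) * (Real.exp 1 / 4) ^ ((K : ℝ) / 2 - 1)) ^ r := by
        rw [← mul_pow]; congr 1; field_simp
    _ ≤ _ := by
        unfold clusterRatio
        have h4 : (n : ℝ) / P ≤ 1 / σ := by
          rw [div_le_div_iff₀ hP' hσ]; linarith
        have h5 : Real.exp 1 ^ 2 / (2 * σ) * K = Real.exp 1 ^ 2 / 2 * K * (1 / σ) := by
          field_simp
        rw [h5]
        gcongr

theorem overlap_exponent_le {n K P r : ℕ} {σ y : ℝ} (hσ : 0 < σ) (hn : 1 ≤ n)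
    (hP : σ * n ≤ P) (hy : y = n * (K : ℝ) ^ 2 / P) (hy8 : y ≤ 8 * Real.log n)
    (hrn : r ≤ n) (hr : (r : ℝ) ≤ Real.exp (7 * Real.log n / 8)) :
    (K : ℝ) * (r * K / P * (Real.exp ((n - r : ℕ) * K / P) - 1) - (n - r : ℕ) * K / P) ≤
      -y + 2 * overlapError σ (Real.log n) := by
  set L := Real.log n with hL
  have hn' : (0 : ℝ) < n := by exact_mod_cast hn
  have hP' : (0 : ℝ) < P := (by positivity : 0 < σ * n).trans_le hP
  have hy0 : 0 ≤ y := by rw [hy]; positivity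
  have hexpL : Real.exp L = n := Real.exp_log hn'
  have hrdiv : (r : ℝ) / n ≤ Real.exp (-(L / 8)) := by
    rw [div_le_iff₀ hn', ← hexpL, ← Real.exp_add]
    refine hr.trans (Real.exp_le_exp.2 ?_)
    linarith
  have hyr : y * (r / n) ≤ 8 * L * Real.exp (-(L / 8)) :=
    mul_le_mul hy8 hrdiv (by positivity) (by linarith)
  have ha : ((n - r : ℕ) * K / P : ℝ) ≤ Real.sqrt (8 * L / σ) := by
    have h1 : ((n - r : ℕ) * K / P : ℝ) ≤ n * K / P := by
      gcongr; exact_mod_cast Nat.sub_le n r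
    refine h1.trans (Real.le_sqrt_of_sq_le ?_)
    have h2 : ((n : ℝ) * K / P) ^ 2 = y * (n / P) := by rw [hy]; field_simp
    have h3 : (n : ℝ) / P ≤ 1 / σ := by
      rw [div_le_div_iff₀ hP' hσ]; linarith
    rw [h2, div_eq_mul_one_div (8 * L)]
    exact mul_le_mul hy8 h3 (by positivity) (by linarith)
  have hK : (K : ℝ) * (r * K / P) = y * (r / n) := by rw [hy]; field_simp
  have hKa : (K : ℝ) * ((n - r : ℕ) * K / P) = y - y * (r / n) := by
    rw [hy, Nat.cast_sub hrn]; field_simp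
  have h4 : y * (r / n) * Real.exp ((n - r : ℕ) * K / P) ≤ overlapError σ L := by
    unfold overlapError
    rw [Real.exp_add, ← mul_assoc]
    exact mul_le_mul hyr (Real.exp_le_exp.2 ha) (Real.exp_pos _).le
      ((by positivity : 0 ≤ y * (r / n)).trans hyr)
  have h5 : y * (r / n) ≤ overlapError σ L := by
    refine le_trans ?_ h4
    refine le_mul_of_one_le_right (by positivity) (Real.one_le_exp (by positivity))
  have h6 : (K : ℝ) * (r * K / P * (Real.exp ((n - r : ℕ) * K / P) - 1) - (n - r : ℕ) * K / P) =
      y * (r / n) * Real.exp ((n - r : ℕ) * K / P) - y := by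
    rw [mul_sub, ← mul_assoc, hK, hKa]; ring
  rw [h6]
  have : 0 ≤ overlapError σ L := (by positivity : 0 ≤ y * (r / n)).trans h5
  linarith

open Classical in
/-- The expected number of cuts with `r` nodes on the small side is bounded by a term of a geometric
series and a remainder whose sum over `r` is at most `2 ^ n * exp (-n K / 8)`. -/
theorem choose_mul_card_filter_isCut_le {n K P : ℕ} {σ y : ℝ} (hσ : 0 < σ)
    (hP : σ * n ≤ P) (hK : 2 ≤ K) (hy : y = n * (K : ℝ) ^ 2 / P)
    (hyL : Real.log n ≤ y) (S : Finset (Fin n)) (hS1 : 1 ≤ S.card) (hS2 : 2 * S.card ≤ n) :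
    (n.choose S.card : ℝ) * (#{R : Fin n → KeyRing K P | IsCut R S} : ℝ) ≤ (P.choose K : ℝ) ^ n *
      (cutRatio σ n K y ^ S.card + n.choose S.card * Real.exp (-(n * K / 8 : ℝ))) := by
  set r := S.card with hr
  set L := Real.log n with hL
  have hn : 0 < n := by omega
  have hn' : (0 : ℝ) < n := by exact_mod_cast hn
  have hr' : (0 : ℝ) < r := by exact_mod_cast hS1
  have hP' : (0 : ℝ) < P := (by positivity : 0 < σ * n).trans_le hP
  have hPn : 0 < P := by exact_mod_cast hP'
  have hK' : (2 : ℝ) ≤ K := by exact_mod_cast hK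
  have hexpL : Real.exp L = n := Real.exp_log hn'
  have hc0 := clusterRatio_nonneg hσ K
  have hN : (0 : ℝ) ≤ (P.choose K : ℝ) ^ n := by positivity
  have hC : (0 : ℝ) ≤ n.choose r := by positivity
  have e1 := Real.exp_pos (-L)
  have e2 := Real.exp_pos (1 - L / 8)
  have e3 := Real.exp_pos (L - y + 2 * overlapError σ L)
  -- The precise estimate is needed only for small sets in a graph of moderate mean degree.
  by_cases hcase : y ≤ 8 * L ∧ (r : ℝ) ≤ Real.exp (7 * L / 8)
  · have h1 := card_filter_isCut_le_exp (K := K) hPn S rfl rfl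
    have h2 := overlap_exponent_le hσ hn hP hy hcase.1 (by omega) hcase.2
    calc (n.choose r : ℝ) * (#{R : Fin n → KeyRing K P | IsCut R S} : ℝ)
        ≤ (n : ℝ) ^ r * ((P.choose K : ℝ) ^ n *
            Real.exp (r * (-y + 2 * overlapError σ L))) := by
          refine mul_le_mul (choose_le_pow_cast n r) (h1.trans ?_) (by positivity) (by positivity)
          gcongr
      _ = (P.choose K : ℝ) ^ n * Real.exp (L - y + 2 * overlapError σ L) ^ r := by
          rw [← hexpL, ← Real.exp_nat_mul, ← Real.exp_nat_mul, mul_left_comm, ← Real.exp_add]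
          congr 2; ring
      _ ≤ (P.choose K : ℝ) ^ n * cutRatio σ n K y ^ r := by
          gcongr
          unfold cutRatio
          linarith
      _ ≤ _ := by
          gcongr
          have : 0 ≤ (n.choose r : ℝ) * Real.exp (-(n * K / 8 : ℝ)) := by positivity
          linarith
  · set t : ℝ := min (r * K / (2 * P)) (1 / 4) with ht
    have ht0 : 0 < t := lt_min (by positivity) (by norm_num)
    have ht1 : t ≤ 1 / 4 := min_le_right _ _
    have ht2 : t ≤ r * K / (2 * P) := min_le_left _ _
    have htP : t * P ≤ (K * r : ℝ) / 2 := by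
      calc t * P ≤ r * K / (2 * P) * P := by gcongr
        _ = _ := by field_simp
    have h1 := card_filter_isCut_le_add (K := K) hPn S ht0 (by linarith) htP
    have h2 := choose_mul_rpow_le_clusterRatio_pow hσ hn hP hK hS1 ht0 ht1 ht2
    have h3 : Real.exp (-((n - r : ℕ) * K * t)) ≤
        Real.exp (-(r * (y / 4))) + Real.exp (-(n * K / 8 : ℝ)) := by
      have hnr : (n : ℝ) / 2 ≤ (n - r : ℕ) := by
        rw [Nat.cast_sub (by omega)]
        have : (2 * r : ℝ) ≤ n := by exact_mod_cast hS2
        linarith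
      have h4 : Real.exp (-((n - r : ℕ) * K * t)) ≤ Real.exp (-(n / 2 * K * t)) := by
        gcongr
      refine h4.trans ?_
      rcases min_choice (r * K / (2 * P) : ℝ) (1 / 4) with h | h
      · have : -((n : ℝ) / 2 * K * t) = -(r * (y / 4)) := by
          rw [ht, h, hy]; field_simp; norm_num
        rw [this]
        linarith [Real.exp_pos (-(n * K / 8 : ℝ))]
      · have : -((n : ℝ) / 2 * K * t) = -(n * K / 8 : ℝ) := by
          rw [ht, h]; ring
        rw [this]
        linarith [Real.exp_pos (-(r * (y / 4)))]
    have h5 : (n.choose r : ℝ) * Real.exp (-(r * (y / 4))) ≤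
        (Real.exp (-L) + Real.exp (1 - L / 8)) ^ r := by
      by_cases hy8 : y ≤ 8 * L
      · have hrL : Real.exp (7 * L / 8) ≤ r := by
          by_contra h
          exact hcase ⟨hy8, (not_le.1 h).le⟩
        calc (n.choose r : ℝ) * Real.exp (-(r * (y / 4)))
            ≤ (Real.exp 1 * n / Real.exp (7 * L / 8)) ^ r * Real.exp (-(L / 4)) ^ r := by
              rw [← Real.exp_nat_mul (-(L / 4))]
              refine mul_le_mul ((choose_le_exp_mul_div_pow hS1).trans ?_)
                (Real.exp_le_exp.2 ?_) (Real.exp_pos _).le (by positivity)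
              · gcongr
              · have := mul_le_mul_of_nonneg_left hyL hr'.le
                linarith
          _ = Real.exp (1 - L / 8) ^ r := by
              rw [← mul_pow, ← hexpL, ← Real.exp_add, ← Real.exp_sub, ← Real.exp_add]
              congr 2; ring
          _ ≤ _ := by gcongr; linarith
      · calc (n.choose r : ℝ) * Real.exp (-(r * (y / 4)))
            ≤ (n : ℝ) ^ r * Real.exp (-(2 * L)) ^ r := by
              rw [← Real.exp_nat_mul (-(2 * L))]
              refine mul_le_mul (choose_le_pow_cast n r)
                (Real.exp_le_exp.2 ?_) (Real.exp_pos _).le (by positivity)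
              have := mul_le_mul_of_nonneg_left (not_le.1 hy8).le hr'.le
              linarith
          _ = Real.exp (-L) ^ r := by
              rw [← mul_pow, ← hexpL, ← Real.exp_add]
              congr 2; ring
          _ ≤ _ := by gcongr; linarith
    calc (n.choose r : ℝ) * (#{R : Fin n → KeyRing K P | IsCut R S} : ℝ)
        ≤ n.choose r * ((P.choose K : ℝ) ^ n * ((Real.exp 1 * t) ^ ((K * r : ℝ) / 2) +
            (Real.exp (-(r * (y / 4))) + Real.exp (-(n * K / 8 : ℝ))))) := by
          gcongr
          refine h1.trans ?_
          gcongr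
      _ = (P.choose K : ℝ) ^ n * (n.choose r * (Real.exp 1 * t) ^ ((K * r : ℝ) / 2) +
            n.choose r * Real.exp (-(r * (y / 4))) +
            n.choose r * Real.exp (-(n * K / 8 : ℝ))) := by ring
      _ ≤ (P.choose K : ℝ) ^ n * (clusterRatio σ K ^ r +
            (Real.exp (-L) + Real.exp (1 - L / 8)) ^ r +
            n.choose r * Real.exp (-(n * K / 8 : ℝ))) := by gcongr
      _ ≤ _ := by
          gcongr
          refine (pow_add_pow_le_add_pow hc0 (by positivity) hS1).trans ?_
          gcongr
          unfold cutRatio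
          linarith

theorem sum_Icc_pow_le {β : ℝ} (hβ0 : 0 ≤ β) (hβ : β ≤ 1 / 2) (m : ℕ) :
    ∑ r ∈ Icc 1 m, β ^ r ≤ 2 * β := by
  suffices h : ∑ r ∈ Icc 1 m, β ^ r ≤ 2 * β - β ^ m * (2 * β) by
    have : 0 ≤ β ^ m * (2 * β) := by positivity
    linarith
  induction m with
  | zero => simp
  | succ m ih =>
    rw [← insert_Icc_right_eq_Icc_add_one (by omega), sum_insert (by simp)]
    have h1 : 0 ≤ β ^ m * β := by positivity
    have h2 : β ^ m * β * β ≤ β ^ m * β * (1 / 2) := by gcongr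
    rw [pow_succ]
    linarith

theorem one_sub_probConnected_le_cutRatio {n K P : ℕ} {σ y : ℝ} (hσ : 0 < σ) (hn : 0 < n)
    (hKP : K ≤ P) (hP : σ * n ≤ P) (hK : 6 ≤ K) (hy : y = n * (K : ℝ) ^ 2 / P)
    (hyL : Real.log n ≤ y) (hβ : cutRatio σ n K y ≤ 1 / 2) :
    1 - probConnected n K P ≤ 2 * cutRatio σ n K y + 2 * Real.exp (-(K / 8 : ℝ)) := by
  set β := cutRatio σ n K y with hβdef
  have hβ0 : 0 ≤ β := by
    have := clusterRatio_nonneg hσ K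
    rw [hβdef]; unfold cutRatio; positivity
  have hchoose : ∀ r ∈ Icc 1 (n / 2), (0 : ℝ) < n.choose r := fun r hr => by
    have : r ≤ n := by rw [mem_Icc] at hr; omega
    exact_mod_cast Nat.choose_pos this
  have h1 := one_sub_probConnected_le hn hKP
    (fun r => (β ^ r + n.choose r * Real.exp (-(n * K / 8 : ℝ))) / n.choose r) (by
      intro S hS1 hS2
      have h2 := choose_mul_card_filter_isCut_le hσ hP (by omega) hy hyL S hS1 hS2
      have h3 : (0 : ℝ) < n.choose S.card := hchoose _ (by rw [mem_Icc]; omega)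
      rw [← mul_div_assoc, le_div_iff₀ h3, mul_comm]
      exact h2)
  have h4 : ∑ r ∈ Icc 1 (n / 2), (n.choose r : ℝ) * ((β ^ r + n.choose r *
      Real.exp (-(n * K / 8 : ℝ))) / n.choose r) = ∑ r ∈ Icc 1 (n / 2), β ^ r +
      (∑ r ∈ Icc 1 (n / 2), (n.choose r : ℝ)) * Real.exp (-(n * K / 8 : ℝ)) := by
    rw [sum_mul, ← sum_add_distrib]
    refine sum_congr rfl fun r hr => ?_
    rw [mul_div_cancel₀ _ (hchoose r hr).ne']
  rw [h4] at h1
  have h5 : ∑ r ∈ Icc 1 (n / 2), (n.choose r : ℝ) ≤ 2 ^ n := by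
    have h6 : ∑ r ∈ Icc 1 (n / 2), n.choose r ≤ 2 ^ n := by
      rw [← Nat.sum_range_choose]
      refine sum_le_sum_of_subset fun r hr => ?_
      rw [mem_Icc] at hr
      rw [mem_range]; omega
    exact_mod_cast h6
  have h7 : (2 : ℝ) ^ n * Real.exp (-(n * K / 8 : ℝ)) ≤ 2 * Real.exp (-(K / 8 : ℝ)) := by
    have h8 : (2 : ℝ) ^ n * Real.exp (-(n * K / 8 : ℝ)) = (2 * Real.exp (-(K / 8 : ℝ))) ^ n := by
      rw [mul_pow, ← Real.exp_nat_mul]; congr 2; ring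
    rw [h8]
    refine pow_le_of_le_one (by positivity) ?_ hn.ne'
    have h9 : (2 : ℝ) ≤ Real.exp (K / 8) := by
      have h10 : (6 : ℝ) ≤ K := by exact_mod_cast hK
      have h11 : Real.log 2 ≤ K / 8 := by linarith [Real.log_two_lt_d9]
      calc (2 : ℝ) = Real.exp (Real.log 2) := (Real.exp_log two_pos).symm
        _ ≤ _ := Real.exp_le_exp.2 h11
    rw [Real.exp_neg]
    exact mul_inv_le_one_of_le₀ h9 (Real.exp_pos _).le
  have h12 := sum_Icc_pow_le hβ0 hβ (n / 2)
  have h13 := mul_le_mul_of_nonneg_right h5 (Real.exp_pos (-(n * K / 8 : ℝ))).le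
  linarith

/-! ### The one law -/

theorem tendsto_clusterRatio (σ : ℝ) : Tendsto (clusterRatio σ) atTop (𝓝 0) := by
  have hb : 0 < (Real.log 4 - 1) / 2 := by
    have : Real.log 4 = 2 * Real.log 2 := by
      rw [show (4 : ℝ) = 2 ^ 2 by norm_num, Real.log_pow]; norm_num
    have := Real.log_two_gt_d9
    linarith
  have h1 := (tendsto_rpow_mul_exp_neg_mul_atTop_nhds_zero 1 _ hb).comp
    (tendsto_natCast_atTop_atTop (R := ℝ))
  have h2 := h1.const_mul (Real.exp 1 ^ 2 / (2 * σ) * Real.exp (Real.log 4 - 1))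
  rw [mul_zero] at h2
  refine h2.congr fun K => ?_
  have h3 : Real.exp 1 / 4 = Real.exp (1 - Real.log 4) := by
    rw [Real.exp_sub, Real.exp_log (by norm_num)]
  have h4 : Real.exp ((1 - Real.log 4) * ((K : ℝ) / 2 - 1)) =
      Real.exp (Real.log 4 - 1) * Real.exp (-((Real.log 4 - 1) / 2) * K) := by
    rw [← Real.exp_add]; congr 1; ring
  simp only [Function.comp, clusterRatio, Real.rpow_one]
  rw [h3, ← Real.exp_mul, h4]
  ring

theorem tendsto_overlapError {σ : ℝ} (hσ : 0 < σ) : Tendsto (overlapError σ) atTop (𝓝 0) := by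
  have h1 := (tendsto_rpow_mul_exp_neg_mul_atTop_nhds_zero 1 (1 / 16) (by norm_num)).const_mul 8
  rw [mul_zero] at h1
  refine squeeze_zero' ?_ ?_ h1
  · filter_upwards [eventually_ge_atTop 0] with L hL
    unfold overlapError; positivity
  · filter_upwards [eventually_ge_atTop (2048 / σ), eventually_ge_atTop 0] with L hL hL0
    unfold overlapError
    rw [Real.rpow_one, mul_assoc]
    have h2 : Real.sqrt (8 * L / σ) ≤ L / 16 := by
      rw [Real.sqrt_le_left (by positivity), div_le_iff₀ hσ]
      rw [div_le_iff₀ hσ] at hL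
      nlinarith
    gcongr
    linarith

theorem tendsto_probConnected_one {K P : ℕ → ℕ} {α : ℕ → ℝ} (hadm : IsAdmissible K P)
    (hdev : IsDeviation K P α) {σ : ℝ} (hσ : 0 < σ)
    (hP : ∀ᶠ n : ℕ in atTop, σ * (n : ℝ) ≤ (P n : ℝ)) (hα : Tendsto α atTop atTop) :
    Tendsto (fun n => probConnected n (K n) (P n)) atTop (𝓝 1) := by
  have hlog : Tendsto (fun n : ℕ => Real.log n) atTop atTop :=
    Real.tendsto_log_atTop.comp tendsto_natCast_atTop_atTop
  have hy : ∀ n : ℕ, 1 ≤ n → Real.log n + α n = n * (K n : ℝ) ^ 2 / P n := by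
    intro n hn
    have hn' : (0 : ℝ) < n := by exact_mod_cast hn
    rw [mul_div_assoc, hdev n hn]; field_simp
  -- `K² = P y / n ≥ σ y`, so the key rings grow.
  have hKtop : Tendsto K atTop atTop := by
    rw [← tendsto_natCast_atTop_iff (R := ℝ)]
    have h1 : Tendsto (fun n : ℕ => Real.sqrt (σ * Real.log n)) atTop atTop :=
      Real.tendsto_sqrt_atTop.comp (hlog.const_mul_atTop hσ)
    refine tendsto_atTop_mono' _ ?_ h1
    filter_upwards [hP, hα.eventually_ge_atTop 0, eventually_ge_atTop 1] with n hPn hαn hn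
    have hn' : (0 : ℝ) < n := by exact_mod_cast hn
    have hP' : (0 : ℝ) < P n := (by positivity : 0 < σ * n).trans_le hPn
    refine Real.sqrt_le_iff.2 ⟨by positivity, ?_⟩
    have h2 : Real.log n ≤ n * (K n : ℝ) ^ 2 / P n := by rw [← hy n hn]; linarith
    rw [le_div_iff₀ hP'] at h2
    have h3 : Real.log n * (σ * n) ≤ Real.log n * P n :=
      mul_le_mul_of_nonneg_left hPn (Real.log_natCast_nonneg n)
    have h4 : σ * Real.log n * n ≤ (K n : ℝ) ^ 2 * n := by linarith
    exact le_of_mul_le_mul_right h4 hn'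
  have hβ : Tendsto (fun n => cutRatio σ n (K n) (Real.log n + α n)) atTop (𝓝 0) := by
    have h1 := (tendsto_clusterRatio σ).comp hKtop
    have h2 := Real.tendsto_exp_neg_atTop_nhds_zero.comp hlog
    have h3 : Tendsto (fun n : ℕ => Real.exp (1 - Real.log n / 8)) atTop (𝓝 0) := by
      refine Real.tendsto_exp_atBot.comp ?_
      exact tendsto_atBot_add_const_left _ 1
        (tendsto_neg_atTop_atBot.comp (hlog.atTop_div_const (by norm_num)))
    have h4 : Tendsto (fun n : ℕ => Real.exp (Real.log n - (Real.log n + α n) +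
        2 * overlapError σ (Real.log n))) atTop (𝓝 0) := by
      refine Real.tendsto_exp_atBot.comp ?_
      have h5 := ((tendsto_overlapError hσ).comp hlog).const_mul 2
      have h6 := (tendsto_neg_atTop_atBot.comp hα).atBot_add h5
      refine h6.congr fun n => ?_
      simp only [Function.comp]; ring
    have h5 := ((h1.add h2).add h3).add h4
    simp only [add_zero] at h5
    exact h5
  have hbound : Tendsto (fun n => 2 * cutRatio σ n (K n) (Real.log n + α n) +
      2 * Real.exp (-(K n / 8 : ℝ))) atTop (𝓝 0) := by
    have h1 : Tendsto (fun n => Real.exp (-(K n / 8 : ℝ))) atTop (𝓝 0) :=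
      Real.tendsto_exp_neg_atTop_nhds_zero.comp
        ((tendsto_natCast_atTop_atTop.comp hKtop).atTop_div_const (by norm_num))
    simpa using (hβ.const_mul 2).add (h1.const_mul 2)
  have hdiff : Tendsto (fun n => 1 - probConnected n (K n) (P n)) atTop (𝓝 0) := by
    refine squeeze_zero' ?_ ?_ hbound
    · filter_upwards [eventually_ge_atTop 1] with n hn
      have h1 := hadm.1 n hn
      have : Nonempty (KeyRing (K n) (P n)) := Fintype.card_pos_iff.1 (by
        rw [card_keyRing]; exact Nat.choose_pos h1)
      have : IsProbabilityMeasure (keyRingLaw (K n) (P n)) :=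
        isProbabilityMeasure_uniformOn Set.finite_univ Set.univ_nonempty
      have : IsProbabilityMeasure (keyRingsLaw n (K n) (P n)) := by
        unfold keyRingsLaw; infer_instance
      exact sub_nonneg.2 measureReal_le_one
    · filter_upwards [eventually_ge_atTop 1, hP, hKtop.eventually_ge_atTop 6,
        hα.eventually_ge_atTop 0, hβ.eventually_le_const (by norm_num : (0 : ℝ) < 1 / 2)]
        with n hn hPn hKn hαn hβn
      exact one_sub_probConnected_le_cutRatio hσ hn (hadm.1 n hn) hPn hKn (hy n hn)
        (by linarith) hβn
  simpa using (tendsto_const_nhds (x := (1 : ℝ))).sub hdiff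

/-! ### Isolated nodes and the zero law -/

theorem not_connected_of_isCut_singleton {n K P : ℕ} (hn : 2 ≤ n) {R : Fin n → KeyRing K P}
    {i : Fin n} (h : IsCut R {i}) : ¬ (keyGraph R).Connected := by
  intro hc
  have : Nontrivial (Fin n) := Fin.nontrivial_iff_two_le.2 hn
  refine hc.preconnected.not_isIsolated i fun j hij => ?_
  have h1 := h i (mem_singleton_self i) j (by simpa using hij.1.symm)
  exact hij.2.ne_empty (disjoint_iff_inter_eq_empty.1 h1.symm)

open Classical in
theorem card_filter_isCut_singleton {n K P : ℕ} (i : Fin n) :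
    #{R : Fin n → KeyRing K P | IsCut R {i}} = P.choose K * ((P - K).choose K) ^ (n - 1) := by
  rw [card_filter_isCut]
  have h1 : ∀ f : {j // j ∈ ({i} : Finset (Fin n))} → KeyRing K P, (keyUnion f).card = K := by
    intro f
    have : keyUnion f = (f ⟨i, mem_singleton_self i⟩).1 := by
      ext x
      simp only [keyUnion, mem_biUnion, mem_univ, true_and]
      constructor
      · rintro ⟨⟨j, hj⟩, hx⟩
        obtain rfl := mem_singleton.1 hj
        exact hx
      · exact fun hx => ⟨_, hx⟩
    rw [this]
    exact (f _).2
  simp_rw [h1]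
  rw [sum_const, card_univ, Fintype.card_fun, card_keyRing, Fintype.card_coe, card_singleton,
    pow_one, smul_eq_mul]

open Classical in
/-- If two nodes are both isolated, their key rings are disjoint and the other nodes avoid the
`2 * K` keys in them. -/
theorem card_filter_isCut_pair_le {n K P : ℕ} {i j : Fin n} (hij : i ≠ j) :
    #{R : Fin n → KeyRing K P | IsCut R {i} ∧ IsCut R {j}} ≤
      P.choose K * ((P - K).choose K * ((P - 2 * K).choose K) ^ (n - 2)) := by
  let F (A B : KeyRing K P) (k : Fin n) : Finset (KeyRing K P) :=
    if k = i then {A} else if k = j then {B} else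
      univ.filter fun C : KeyRing K P => Disjoint C.1 (A.1 ∪ B.1)
  have hsub : ({R : Fin n → KeyRing K P | IsCut R {i} ∧ IsCut R {j}} : Finset _) ⊆
      (univ : Finset (KeyRing K P)).biUnion fun A =>
        ({B : KeyRing K P | Disjoint B.1 A.1} : Finset _).biUnion fun B =>
          Fintype.piFinset (F A B) := by
    intro R hR
    simp only [mem_filter, mem_univ, true_and] at hR
    have hi : ∀ k, k ≠ i → Disjoint (R k).1 (R i).1 := fun k hk =>
      hR.1 i (mem_singleton_self i) k (by simpa using hk)
    have hj : ∀ k, k ≠ j → Disjoint (R k).1 (R j).1 := fun k hk =>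
      hR.2 j (mem_singleton_self j) k (by simpa using hk)
    simp only [mem_biUnion, mem_filter, mem_univ, true_and, Fintype.mem_piFinset]
    refine ⟨R i, R j, hi j hij.symm, fun k => ?_⟩
    simp only [F]
    split_ifs with h1 h2
    · rw [h1]; exact mem_singleton_self _
    · rw [h2]; exact mem_singleton_self _
    · simp only [mem_filter, mem_univ, true_and, disjoint_union_right]
      exact ⟨hi k h1, hj k h2⟩
  refine (card_le_card hsub).trans ?_
  refine (card_biUnion_le_card_mul _ _ ((P - K).choose K * ((P - 2 * K).choose K) ^ (n - 2))
    fun A _ => ?_).trans_eq (by rw [card_univ, card_keyRing])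
  refine (card_biUnion_le_card_mul _ _ (((P - 2 * K).choose K) ^ (n - 2))
    fun B hB => ?_).trans_eq (by rw [card_filter_disjoint, A.2])
  have hd : Disjoint A.1 B.1 := by simpa [disjoint_comm] using hB
  have hF : ∀ k, (F A B k).card =
      if k ∈ ({i, j} : Finset (Fin n)) then 1 else (P - 2 * K).choose K := by
    intro k
    simp only [F, mem_insert, mem_singleton]
    by_cases h1 : k = i
    · simp [h1]
    · by_cases h2 : k = j
      · simp [h2, hij.symm]
      · simp only [h1, h2, if_false, or_self]
        rw [card_filter_disjoint, card_union_of_disjoint hd, A.2, B.2, two_mul]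
  rw [Fintype.card_piFinset]
  simp_rw [hF]
  rw [prod_ite, prod_const_one, one_mul, prod_const, filter_not, filter_univ_mem,
    ← compl_eq_univ_sdiff, card_compl, card_pair hij, Fintype.card_fin]

/-- Being disjoint from two disjoint key rings is negatively correlated. When `P < 2 * K`
and `0 < b` the left side vanishes by truncated subtraction. -/
theorem choose_sub_two_mul_mul_choose_le (K P : ℕ) (b : ℕ) :
    (P - 2 * K).choose b * P.choose b ≤ (P - K).choose b ^ 2 := by
  have h : ∀ b, (P - 2 * K).descFactorial b * P.descFactorial b ≤
      ((P - K).descFactorial b) ^ 2 := by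
    intro b
    induction b with
    | zero => simp
    | succ b ih =>
      have h1 : (P - 2 * K - b) * (P - b) ≤ (P - K - b) ^ 2 := by
        rcases le_total P (2 * K + b) with hle | hle
        · rw [show P - 2 * K - b = 0 by omega]; simp
        · obtain ⟨c, rfl⟩ := Nat.exists_eq_add_of_le hle
          rw [show 2 * K + b + c - 2 * K - b = c by omega,
            show 2 * K + b + c - b = 2 * K + c by omega,
            show 2 * K + b + c - K - b = K + c by omega]
          nlinarith
      rw [Nat.descFactorial_succ, Nat.descFactorial_succ, Nat.descFactorial_succ]
      calc _ = (P - 2 * K - b) * (P - b) *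
            ((P - 2 * K).descFactorial b * P.descFactorial b) := by ring
        _ ≤ (P - K - b) ^ 2 * ((P - K).descFactorial b) ^ 2 := Nat.mul_le_mul h1 ih
        _ = _ := by ring
  have h2 := h b
  simp only [Nat.descFactorial_eq_factorial_mul_choose] at h2
  have h3 : 0 < b.factorial ^ 2 := pow_pos b.factorial_pos 2
  refine Nat.le_of_mul_le_mul_left ?_ h3
  calc _ = _ := by ring
    _ ≤ _ := h2
    _ = _ := by ring

/-- Two key rings are disjoint with probability at least `1 - K² / P`. -/
theorem choose_mul_one_sub_le {K P : ℕ} (hK : 1 ≤ K) (hKP : K ≤ P) :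
    (P.choose K : ℝ) * (1 - (K : ℝ) ^ 2 / P) ≤ (P - K).choose K := by
  classical
  have hP : (0 : ℝ) < P := by exact_mod_cast (by omega : 0 < P)
  obtain ⟨V, -, hV⟩ := exists_subset_card_eq (s := (univ : Finset (Fin P))) (n := K) (by simpa)
  have h1 := card_filter_add_card_filter_not (s := (univ : Finset (KeyRing K P)))
    (fun A => Disjoint A.1 V)
  rw [card_filter_disjoint, hV, card_univ, card_keyRing] at h1
  have h2 : #{A : KeyRing K P | ¬ Disjoint A.1 V} ≤ K * (P - 1).choose (K - 1) := by
    have hsub : ({A : KeyRing K P | ¬ Disjoint A.1 V} : Finset _) ⊆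
        V.biUnion fun k => {A : KeyRing K P | {k} ⊆ A.1} := by
      intro A hA
      simp only [mem_filter, mem_univ, true_and, not_disjoint_iff] at hA
      obtain ⟨k, hkA, hkV⟩ := hA
      simp only [mem_biUnion, mem_filter, mem_univ, true_and, singleton_subset_iff]
      exact ⟨k, hkV, hkA⟩
    refine (card_le_card hsub).trans ((card_biUnion_le_card_mul _ _ _ fun k _ => ?_).trans_eq
      (by rw [hV]))
    rw [card_filter_superset K {k} (by simpa using hK), card_singleton]
  have h3 : P * (P - 1).choose (K - 1) = P.choose K * K := by
    have := Nat.add_one_mul_choose_eq (P - 1) (K - 1)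
    rwa [Nat.sub_add_cancel (hK.trans hKP), Nat.sub_add_cancel hK] at this
  have h1' : ((P - K).choose K : ℝ) + #{A : KeyRing K P | ¬ Disjoint A.1 V} = P.choose K := by
    exact_mod_cast h1
  have h2' : (#{A : KeyRing K P | ¬ Disjoint A.1 V} : ℝ) ≤ K * (P - 1).choose (K - 1) := by
    exact_mod_cast h2
  have h3' : (P : ℝ) * (P - 1).choose (K - 1) = P.choose K * K := by exact_mod_cast h3
  have h4 : (K : ℝ) * (P - 1).choose (K - 1) = P.choose K * ((K : ℝ) ^ 2 / P) := by
    field_simp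
    linear_combination h3'
  rw [mul_sub, mul_one]
  linarith

/-- Chebyshev's inequality for a sum of indicators on a finite set of `M` equally likely points:
if every event has `m₁` points and any two have at most `m₂` in common, the points in none of the
events are few. -/
theorem card_filter_none_le {Ω ι : Type*} [Fintype Ω] [Fintype ι] (p : ι → Ω → Prop)
    [∀ i, DecidablePred (p i)] [DecidablePred fun ω => ∀ i, ¬ p i ω] {m₁ m₂ : ℝ}
    (h1 : ∀ i, (#{ω | p i ω} : ℝ) = m₁)
    (h2 : ∀ i j, i ≠ j → (#{ω | p i ω ∧ p j ω} : ℝ) ≤ m₂) (hm₂ : 0 ≤ m₂) :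
    (#{ω | ∀ i, ¬ p i ω} : ℝ) * (Fintype.card ι * m₁) ^ 2 ≤
      (Fintype.card Ω : ℝ) ^ 2 * (Fintype.card ι * m₁ + (Fintype.card ι : ℝ) ^ 2 * m₂) -
        Fintype.card Ω * (Fintype.card ι * m₁) ^ 2 := by
  classical
  set M : ℝ := (Fintype.card Ω : ℝ)
  set c : ℝ := (Fintype.card ι : ℝ)
  let X : Ω → ℝ := fun ω => ∑ i, if p i ω then 1 else 0
  have hX1 : ∑ ω, X ω = c * m₁ := by
    simp only [X]
    rw [sum_comm]
    simp_rw [sum_boole, h1]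
    rw [sum_const, card_univ, nsmul_eq_mul]
  have hX2 : ∑ ω, X ω ^ 2 ≤ c * m₁ + c ^ 2 * m₂ := by
    have h3 : ∀ ω, X ω ^ 2 = ∑ i, ∑ j, if p i ω ∧ p j ω then 1 else 0 := by
      intro ω
      simp only [X, sq, sum_mul_sum]
      refine sum_congr rfl fun i _ => sum_congr rfl fun j _ => ?_
      by_cases hi : p i ω <;> by_cases hj : p j ω <;> simp [hi, hj]
    simp_rw [h3]
    rw [sum_comm]
    simp_rw [sum_comm (s := (univ : Finset Ω)) (t := (univ : Finset ι)), sum_boole]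
    have h4 : ∀ i j, (#{ω | p i ω ∧ p j ω} : ℝ) ≤ (if i = j then m₁ else 0) + m₂ := by
      intro i j
      split_ifs with h
      · subst h
        simp_rw [and_self]
        rw [h1]; linarith
      · rw [zero_add]; exact h2 i j h
    refine (sum_le_sum fun i _ => sum_le_sum fun j _ => h4 i j).trans_eq ?_
    simp only [sum_add_distrib, sum_ite_eq, mem_univ, if_true, sum_const, card_univ, nsmul_eq_mul]
    ring
  have hvar : ∑ ω, (M * X ω - c * m₁) ^ 2 = M ^ 2 * ∑ ω, X ω ^ 2 - M * (c * m₁) ^ 2 := by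
    have : ∀ ω, (M * X ω - c * m₁) ^ 2 =
        M ^ 2 * X ω ^ 2 - 2 * M * (c * m₁) * X ω + (c * m₁) ^ 2 := fun ω => by ring
    simp_rw [this]
    rw [sum_add_distrib, sum_sub_distrib, ← mul_sum, ← mul_sum, hX1, sum_const, card_univ,
      nsmul_eq_mul]
    ring
  calc (#{ω | ∀ i, ¬ p i ω} : ℝ) * (c * m₁) ^ 2
      = ∑ ω ∈ ({ω | ∀ i, ¬ p i ω} : Finset Ω), (M * X ω - c * m₁) ^ 2 := by
        rw [← nsmul_eq_mul, ← sum_const]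
        refine sum_congr rfl fun ω hω => ?_
        simp only [mem_filter, mem_univ, true_and] at hω
        have : X ω = 0 := sum_eq_zero fun i _ => if_neg (hω i)
        rw [this]; ring
    _ ≤ ∑ ω, (M * X ω - c * m₁) ^ 2 :=
        sum_le_sum_of_subset_of_nonneg (subset_univ _) fun _ _ _ => sq_nonneg _
    _ ≤ _ := by
        rw [hvar]
        gcongr

/-- The second moment bound for the number of isolated nodes, where `q` is the probability that
two key rings are disjoint. -/
theorem probConnected_le {n K P : ℕ} (hn : 2 ≤ n) (hKP : K ≤ P) {q : ℝ}
    (hq : q = ((P - K).choose K : ℝ) / P.choose K) (hq0 : 0 < q) :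
    probConnected n K P ≤ 1 / (n * q ^ (n - 1)) + (1 / q - 1) := by
  classical
  set N : ℝ := (P.choose K : ℝ) with hNdef
  set D : ℝ := ((P - K).choose K : ℝ) with hDdef
  set E : ℝ := ((P - 2 * K).choose K : ℝ) with hEdef
  have hN : 0 < N := Nat.cast_pos.2 (Nat.choose_pos hKP)
  have hn' : (0 : ℝ) < n := by exact_mod_cast (by omega : 0 < n)
  have hD : D = q * N := by rw [hq]; field_simp
  have hE0 : 0 ≤ E := by positivity
  have hEN : E ≤ q ^ 2 * N := by
    have h1 : E * N ≤ D ^ 2 := by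
      rw [hEdef, hNdef, hDdef]
      exact_mod_cast choose_sub_two_mul_mul_choose_le K P K
    rw [hD, mul_pow, sq N, ← mul_assoc] at h1
    exact le_of_mul_le_mul_right h1 hN
  obtain ⟨k, rfl⟩ := Nat.exists_eq_add_of_le' hn
  have h1 := card_filter_none_le (fun (i : Fin (k + 2)) (R : Fin (k + 2) → KeyRing K P) =>
    IsCut R {i}) (m₁ := N * D ^ (k + 1)) (m₂ := N * (D * E ^ k))
    (fun i => by rw [card_filter_isCut_singleton]; push_cast; rfl)
    (fun i j hij => by
      rw [hEdef, hNdef, hDdef]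
      exact_mod_cast card_filter_isCut_pair_le hij) (by positivity)
  rw [Fintype.card_fun, card_keyRing, Fintype.card_fin] at h1
  rw [probConnected, keyRingsLaw_real hKP]
  rw [← hNdef, div_le_iff₀ (by positivity)]
  refine (Nat.cast_le.2 (card_le_card (t := {R | ∀ i, ¬ IsCut R {i}}) fun R hR => ?_)).trans ?_
  · simp only [Set.mem_ofPred_eq, mem_filter, mem_univ, true_and] at hR ⊢
    exact fun i hi => not_connected_of_isCut_singleton hn hi hR
  set Z : ℝ := (#{R : Fin (k + 2) → KeyRing K P | ∀ i, ¬ IsCut R {i}} : ℝ)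
  set c : ℝ := ((k + 2 : ℕ) : ℝ)
  have hm : N * D ^ (k + 1) = q ^ (k + 1) * N ^ (k + 2) := by rw [hD, mul_pow]; ring
  have hm2 : N * (D * E ^ k) ≤ q ^ (2 * k + 1) * N ^ (k + 2) := by
    calc N * (D * E ^ k) ≤ N * (q * N * (q ^ 2 * N) ^ k) := by rw [hD]; gcongr
      _ = _ := by rw [mul_pow, ← pow_mul]; ring
  rw [hm] at h1
  have hpos : 0 < (c * (q ^ (k + 1) * N ^ (k + 2))) ^ 2 := by positivity
  refine le_of_mul_le_mul_right (h1.trans ?_) hpos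
  have h3 : ((P.choose K ^ (k + 2) : ℕ) : ℝ) = N ^ (k + 2) := by push_cast; rfl
  rw [h3, show k + 2 - 1 = k + 1 by omega]
  calc (N ^ (k + 2)) ^ 2 * (c * (q ^ (k + 1) * N ^ (k + 2)) + c ^ 2 * (N * (D * E ^ k))) -
        N ^ (k + 2) * (c * (q ^ (k + 1) * N ^ (k + 2))) ^ 2
      ≤ (N ^ (k + 2)) ^ 2 * (c * (q ^ (k + 1) * N ^ (k + 2)) +
          c ^ 2 * (q ^ (2 * k + 1) * N ^ (k + 2))) -
        N ^ (k + 2) * (c * (q ^ (k + 1) * N ^ (k + 2))) ^ 2 := by gcongr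
    _ = _ := by field_simp; ring

theorem tendsto_probConnected_zero {K P : ℕ → ℕ} {α : ℕ → ℝ} (hadm : IsAdmissible K P)
    (hdev : IsDeviation K P α) (hα : Tendsto α atTop atBot) :
    Tendsto (fun n => probConnected n (K n) (P n)) atTop (𝓝 0) := by
  have hlogdiv : Tendsto (fun n : ℕ => Real.log n / n) atTop (𝓝 0) :=
    Real.isLittleO_log_id_atTop.tendsto_div_nhds_zero.comp tendsto_natCast_atTop_atTop
  have hx0 : ∀ n, 0 ≤ (K n : ℝ) ^ 2 / P n := fun n => by positivity
  have hxle : ∀ᶠ n : ℕ in atTop, (K n : ℝ) ^ 2 / P n ≤ Real.log n / n := by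
    filter_upwards [hα.eventually_le_atBot 0, eventually_ge_atTop 1] with n hαn hn
    rw [hdev n hn]
    gcongr
    linarith
  have hx : Tendsto (fun n => (K n : ℝ) ^ 2 / P n) atTop (𝓝 0) :=
    squeeze_zero' (Eventually.of_forall hx0) hxle hlogdiv
  have hbound : Tendsto (fun n => Real.exp (α n + 8) + (1 / (1 - (K n : ℝ) ^ 2 / P n) - 1))
      atTop (𝓝 0) := by
    have h1 : Tendsto (fun n => Real.exp (α n + 8)) atTop (𝓝 0) :=
      Real.tendsto_exp_atBot.comp (tendsto_atBot_add_const_right _ 8 hα)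
    have h2 : Tendsto (fun n => 1 / (1 - (K n : ℝ) ^ 2 / P n) - 1) atTop (𝓝 (1 / (1 - 0) - 1)) :=
      (tendsto_const_nhds.div (hx.const_sub 1) (by norm_num)).sub_const 1
    simpa using h1.add h2
  refine squeeze_zero' (Eventually.of_forall fun n => measureReal_nonneg) ?_ hbound
  filter_upwards [hxle, hx.eventually_le_const (by norm_num : (0 : ℝ) < 1 / 2), hadm.2,
    eventually_ge_atTop 2] with n hxn hxhalf hKn hn
  have hKP := hadm.1 n (by omega)
  have hdevn := hdev n (by omega)
  have hn' : (0 : ℝ) < n := by exact_mod_cast (by omega : 0 < n)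
  have hxn0 := hx0 n
  set x : ℝ := (K n : ℝ) ^ 2 / P n
  have hN : (0 : ℝ) < (P n).choose (K n) := by exact_mod_cast Nat.choose_pos hKP
  set q : ℝ := ((P n - K n).choose (K n) : ℝ) / (P n).choose (K n) with hq
  have hxq : 1 - x ≤ q := by
    rw [hq, le_div_iff₀ hN, mul_comm]
    exact choose_mul_one_sub_le (by omega) hKP
  have hx1 : 0 < 1 - x := by linarith
  have hq0 : 0 < q := hx1.trans_le hxq
  refine (probConnected_le hn hKP hq hq0).trans ?_
  have h1 : 1 / q ≤ 1 / (1 - x) := one_div_le_one_div_of_le hx1 hxq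
  have h2 : 1 / (n * q ^ (n - 1)) ≤ Real.exp (α n + 8) := by
    have h3 : (1 - x) ^ n ≤ q ^ (n - 1) := by
      calc (1 - x) ^ n ≤ (1 - x) ^ (n - 1) :=
            pow_le_pow_of_le_one hx1.le (by linarith) (Nat.sub_le n 1)
        _ ≤ _ := by gcongr
    -- `log (1 / (1 - x)) ≤ 1 / (1 - x) - 1 ≤ x + 2 x²` on `[0, 1 / 2]`.
    have h4 : 1 / (1 - x) ≤ Real.exp (x + 2 * x ^ 2) := by
      refine le_trans ?_ (Real.add_one_le_exp _)
      rw [div_le_iff₀ hx1]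
      nlinarith [mul_nonneg (sq_nonneg x) (by linarith : 0 ≤ 1 - 2 * x)]
    have h5 : (n : ℝ) * x = Real.log n + α n := by rw [hdevn]; field_simp
    have h6 : (n : ℝ) * x ^ 2 ≤ 4 := by
      have h7 : Real.log n ≤ 2 * Real.sqrt n := by
        have := Real.log_le_rpow_div hn'.le (by norm_num : (0 : ℝ) < 1 / 2)
        rw [← Real.sqrt_eq_rpow] at this
        linarith
      have h8 : Real.log n ^ 2 ≤ 4 * n := by
        calc Real.log n ^ 2 ≤ (2 * Real.sqrt n) ^ 2 :=
              pow_le_pow_left₀ (Real.log_natCast_nonneg n) h7 2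
          _ = 4 * n := by rw [mul_pow, Real.sq_sqrt hn'.le]; norm_num
      calc (n : ℝ) * x ^ 2 ≤ n * (Real.log n / n) ^ 2 := by gcongr
        _ = Real.log n ^ 2 / n := by field_simp
        _ ≤ 4 := by rwa [div_le_iff₀ hn']
    calc 1 / (n * q ^ (n - 1)) ≤ 1 / (n * (1 - x) ^ n) := by gcongr
      _ = (n : ℝ)⁻¹ * (1 / (1 - x)) ^ n := by rw [one_div_pow]; field_simp
      _ ≤ (n : ℝ)⁻¹ * Real.exp (x + 2 * x ^ 2) ^ n := by
          have : 0 ≤ 1 / (1 - x) := by positivity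
          gcongr
      _ = Real.exp (α n + 2 * (n * x ^ 2)) := by
          rw [← Real.exp_log (inv_pos.2 hn'), Real.log_inv, ← Real.exp_nat_mul, ← Real.exp_add]
          congr 1
          linear_combination h5
      _ ≤ _ := Real.exp_le_exp.2 (by linarith)
  linarith

end RandomKey

theorem theorem1 (K P : ℕ → ℕ) (α : ℕ → ℝ)
    (hadm : RandomKey.IsAdmissible K P) (hdev : RandomKey.IsDeviation K P α) :
    (Tendsto α atTop atBot →
      Tendsto (fun n => RandomKey.probConnected n (K n) (P n)) atTop (𝓝 0)) ∧
    ((∃ σ : ℝ, 0 < σ ∧ ∀ᶠ n : ℕ in atTop, σ * (n : ℝ) ≤ (P n : ℝ)) →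
      Tendsto α atTop atTop →
      Tendsto (fun n => RandomKey.probConnected n (K n) (P n)) atTop (𝓝 1)) :=
  ⟨RandomKey.tendsto_probConnected_zero hadm hdev, fun ⟨_, hσ, hP⟩ hα =>
    RandomKey.tendsto_probConnected_one hadm hdev hσ hP hα⟩
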